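/- Let $n\ge 1$ and put $p_i := 1/\sqrt{i(i+1)}$ for $i\ge 1$. For a real number $w>-1$ with $w(n-1)<1$ (that is, $-1<w<\frac1{n-1}$, where for $n=1$ there is no upper bound), let $v_1,\dots,v_n\in\mathbb R^n$ be unit vectors with $v_i\cdot v_j=-w$ for $i\ne j$, and let $$\mathcal Q_n(w)=\Big\{\sum_{i=1}^n\lambda_i v_i : 1\ge\lambda_1\ge\cdots\ge\lambda_n\ge 0\Big\},\qquad \mathcal O_n=\mathcal Q_n(0)=\{x\in\mathbb R^n: 1\ge x_1\ge\cdots\ge x_n\ge 0\}$$ (for $\mathcal O_n$ the $v_i$ are the standard basis). A polytope in $\mathbb R^n$ is a union of a finite, positive number of $n$-dimensional simplices. Two sets $P,Q\subset\mathbb R^n$ are equidissectable with $k$ pieces, $k\ge 1$, if there are polytopes $P_1,\dots,P_k$ with pairwise disjoint interiors and union $P$, and polytopes $Q_1,\dots,Q_k$ with pairwise disjoint interiors and union $Q$, such that for each $i$ some isometry of $\mathbb R^n$ maps $P_i$ onto $Q_i$. Write $I_\ell=[0,\ell]$. Then: (a) $\mathcal O_n$ is equidissectable, with at most $n!$ pieces,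 with the brick $$I_{p_1}\times I_{p_2}\times\cdots\times I_{p_{n-1}}\times I_{1/\sqrt n},\qquad p_1=\tfrac1{\sqrt2}.$$ (b) More generally, for every such $w$ and every choice of such $v_1,\dots,v_n$, the simplex $\mathcal Q_n(w)$ is equidissectable, with at most $n!$ pieces, with the brick $$I_{\sqrt{1+w}\,p_1}\times\cdots\times I_{\sqrt{1+w}\,p_{n-1}}\times I_{\ell},\qquad \ell=\sqrt{\frac{1-w(n-1)}{n}}.$$ (For $n=1$ the brick is the single interval $I_1$ in both cases.) -/

import Mathlib

/-- A system of `n` unit vectors in `ℝⁿ` with pairwise inner products `-w`. -/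
structure IsHillSystem {n : ℕ} (w : ℝ) (v : Fin n → EuclideanSpace ℝ (Fin n)) : Prop where
  norm_eq_one : ∀ i, ‖v i‖ = 1
  inner_eq : ∀ i j, i ≠ j → inner ℝ (v i) (v j) = -w

/-- The Hill simplex of the first type spanned by `v`: all points `∑ i, c i • v i` with
`1 ≥ c 1 ≥ ⋯ ≥ c n ≥ 0`. When `v` satisfies `IsHillSystem w v` this is `𝒬ₙ(w)`. -/
def hillSimplex {n : ℕ} (v : Fin n → EuclideanSpace ℝ (Fin n)) :
    Set (EuclideanSpace ℝ (Fin n)) :=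
  {x | ∃ c : Fin n → ℝ, Antitone c ∧ (∀ i, 0 ≤ c i ∧ c i ≤ 1) ∧ x = ∑ i, c i • v i}

/-- The orthoscheme `𝒪ₙ = 𝒬ₙ(0)` in its standard position, spanned by the standard basis. -/
def orthoscheme (n : ℕ) : Set (EuclideanSpace ℝ (Fin n)) :=
  hillSimplex fun i => EuclideanSpace.single i (1 : ℝ)

/-- The brick `I_{s 1} × ⋯ × I_{s n}`, a rectangular parallelepiped with side lengths `s`. -/
def brick {n : ℕ} (s : Fin n → ℝ) : Set (EuclideanSpace ℝ (Fin n)) :=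
  {x | ∀ i, 0 ≤ x i ∧ x i ≤ s i}

/-- The number `pᵢ = 1 / √(i (i + 1))`. -/
noncomputable def brickP (i : ℕ) : ℝ := 1 / √((i : ℝ) * ((i : ℝ) + 1))

/-- A polytope in `ℝⁿ`: the union of a finite (positive) number of `n`-dimensional simplices. -/
def IsPolytope {n : ℕ} (P : Set (EuclideanSpace ℝ (Fin n))) : Prop :=
  ∃ m : ℕ, 1 ≤ m ∧ ∃ S : Fin m → Affine.Simplex ℝ (EuclideanSpace ℝ (Fin n)) n,
    P = ⋃ j, convexHull ℝ (Set.range (S j).points)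

/-- `P = P₁ + ⋯ + Pₖ`: the `Pᵢ` are polytopes with pairwise disjoint interiors whose union
is `P`. -/
structure IsDissection {n k : ℕ} (P : Set (EuclideanSpace ℝ (Fin n)))
    (A : Fin k → Set (EuclideanSpace ℝ (Fin n))) : Prop where
  isPolytope : ∀ i, IsPolytope (A i)
  disjoint_interior : ∀ i j, i ≠ j → Disjoint (interior (A i)) (interior (A j))
  iUnion_eq : P = ⋃ i, A i

/-- `P` and `Q` are equidissectable by means of `k` pieces: they have dissections into `k`
polytopes each that correspond to each other under isometries of `ℝⁿ`. -/
def EquidissectableWith {n : ℕ} (k : ℕ) (P Q : Set (EuclideanSpace ℝ (Fin n))) : Prop :=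
  1 ≤ k ∧ ∃ A B : Fin k → Set (EuclideanSpace ℝ (Fin n)),
    IsDissection P A ∧ IsDissection Q B ∧
      ∀ i, ∃ g : EuclideanSpace ℝ (Fin n) ≃ᵢ EuclideanSpace ℝ (Fin n), g '' A i = B i

/-!
In the coordinates `x = ∑ a i • v i` with indices `0, …, n`, extend `a` to a sequence with
`a (m + n + 1) = a m - 1`. The sequences that decrease everywhere form an infinite prism `C`, and
shifting the sequence by one place is an isometry of the space that preserves `C`: up to a
translation it permutes the `v i` cyclically, and their pairwise inner products all agree.
The Hill simplex consists of the sequences of `C` that change sign between the places `n` and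
`n + 1`. It is therefore a fundamental domain for the action of the shift on `C`. So is the slab
`0 ≤ ∑ a i ≤ 1` of `C`, since the shift lowers `∑ a i` by `1`. Cutting the simplex along the
hyperplanes `∑ a i = j` and shifting the `j`-th slice `j` times thus produces the slab
(`scissorsCongruent_hillSimplex_hillPrism`). The slab is bounded by hyperplanes orthogonal to
`∑ v i`, and is a right prism over a Hill simplex of one dimension less
(`hillPrism_eq_cylinder`), so induction on the dimension yields the brick, with
`(n + 1) * n !` pieces in dimension `n + 1` (`scissorsCongruent_hillSimplex_brick`).

The induction is run for vectors with Gram matrix `c • 1 - d • J`, which absorbs the scaling of the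
base of the prism. Its pieces are polyhedra, possibly with empty interior, as compositions of
dissections are formed by intersecting pieces. At the end the pieces without interior
points are discarded, which by Baire's theorem does not affect the union
(`ScissorsCongruent.equidissectableWith`), and the others are polytopes in the required sense by the
theorems of Krein–Milman and Carathéodory (`IsPolyhedron.isPolytope`).
-/

open Set

/-! ### Polyhedra -/

section Polyhedra

variable {E F : Type*} [NormedAddCommGroup E] [NormedSpace ℝ E]
  [NormedAddCommGroup F] [NormedSpace ℝ F]

/-- A convex polyhedron: the solution set of a finite system of weak linear inequalities. It may
be unbounded, empty or of empty interior. -/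
def IsPolyhedron (S : Set E) : Prop :=
  ∃ (ι : Type) (_ : Finite ι) (f : ι → E →ₗ[ℝ] ℝ) (b : ι → ℝ), S = {x | ∀ i, f i x ≤ b i}

theorem isPolyhedron_halfSpace (f : E →ₗ[ℝ] ℝ) (b : ℝ) : IsPolyhedron {x | f x ≤ b} :=
  ⟨Unit, inferInstance, fun _ => f, fun _ => b, by simp⟩

theorem isPolyhedron_halfSpace_ge (f : E →ₗ[ℝ] ℝ) (b : ℝ) : IsPolyhedron {x | b ≤ f x} :=
  ⟨Unit, inferInstance, fun _ => -f, fun _ => -b, by simp⟩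

theorem isPolyhedron_univ : IsPolyhedron (univ : Set E) :=
  ⟨Empty, inferInstance, nofun, nofun, by ext; simp⟩

theorem IsPolyhedron.inter {S T : Set E} (hS : IsPolyhedron S) (hT : IsPolyhedron T) :
    IsPolyhedron (S ∩ T) := by
  obtain ⟨ι, _, f, b, rfl⟩ := hS
  obtain ⟨κ, _, g, c, rfl⟩ := hT
  exact ⟨ι ⊕ κ, inferInstance, Sum.elim f g, Sum.elim b c, by ext; simp⟩

theorem isPolyhedron_iInter {κ : Type} [Finite κ] {S : κ → Set E} (h : ∀ k, IsPolyhedron (S k)) :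
    IsPolyhedron (⋂ k, S k) := by
  choose ι hι f b h using h
  refine ⟨Σ k, ι k, inferInstance, fun p => f p.1 p.2, fun p => b p.1 p.2, ?_⟩
  ext x
  simp [h, Sigma.forall]

theorem IsPolyhedron.preimage {S : Set F} (hS : IsPolyhedron S) (φ : E →ᵃ[ℝ] F) :
    IsPolyhedron (φ ⁻¹' S) := by
  obtain ⟨ι, _, f, b, rfl⟩ := hS
  refine ⟨ι, inferInstance, fun i => f i ∘ₗ φ.linear, fun i => b i - f i (φ 0), ?_⟩
  ext x
  have : φ x = φ.linear x + φ 0 := by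
    have := φ.map_vadd 0 x
    simpa using this
  simp [this, le_sub_iff_add_le]

theorem IsPolyhedron.preimage_isometryEquiv {S : Set F} (hS : IsPolyhedron S) (g : E ≃ᵢ F) :
    IsPolyhedron (g ⁻¹' S) := by
  have := hS.preimage (g.toRealAffineIsometryEquiv.toAffineEquiv : E →ᵃ[ℝ] F)
  exact this

theorem IsPolyhedron.image_isometryEquiv {S : Set E} (hS : IsPolyhedron S) (g : E ≃ᵢ F) :
    IsPolyhedron (g '' S) := by
  have : g '' S = g.symm ⁻¹' S := g.toEquiv.image_eq_preimage_symm S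
  rw [this]
  exact hS.preimage_isometryEquiv g.symm

theorem IsPolyhedron.convex {S : Set E} (hS : IsPolyhedron S) : Convex ℝ S := by
  obtain ⟨ι, _, f, b, rfl⟩ := hS
  rw [ofPred_forall]
  exact convex_iInter fun i => convex_halfSpace_le (f i).isLinear (b i)

theorem IsPolyhedron.isClosed [FiniteDimensional ℝ E] {S : Set E} (hS : IsPolyhedron S) :
    IsClosed S := by
  obtain ⟨ι, _, f, b, rfl⟩ := hS
  rw [ofPred_forall]
  exact isClosed_iInter fun i =>
    isClosed_le (f i).continuous_of_finiteDimensional continuous_const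

/-- An extreme point of a polyhedron is determined by the set of inequalities that are equalities
there: if `x` and `y` have the same such set, then `x ± ε (y - x)` lie in the polyhedron for
small `ε > 0`. -/
theorem IsPolyhedron.finite_extremePoints {S : Set E} (hS : IsPolyhedron S) :
    (S.extremePoints ℝ).Finite := by
  obtain ⟨ι, _, f, b, rfl⟩ := hS
  refine Set.Finite.of_injOn (f := fun x => {i | f i x = b i}) (t := univ) (fun _ _ => mem_univ _)
    ?_ finite_univ
  intro x hx y hy hxy
  have hact : ∀ i, f i x = b i ↔ f i y = b i := fun i => by
    have : i ∈ {i | f i x = b i} ↔ i ∈ {i | f i y = b i} := by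
      simp only at hxy; rw [hxy]
    simpa using this
  have hxS := hx.1
  have hyS := hy.1
  simp only [mem_ofPred_eq] at hxS hyS
  obtain ⟨ε, hε, h⟩ : ∃ ε > 0, ∀ i, ε * (f i x - f i y) ≤ b i - f i x := by
    have : ∀ i, ∃ ε > 0, ε * (f i x - f i y) ≤ b i - f i x := by
      intro i
      rcases (hxS i).eq_or_lt with h | h
      · exact ⟨1, one_pos, by linarith [(hact i).1 h]⟩
      · refine ⟨(b i - f i x) / (|f i x - f i y| + 1), div_pos (by linarith) (by positivity), ?_⟩
        rw [div_mul_eq_mul_div, div_le_iff₀ (by positivity)]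
        exact mul_le_mul_of_nonneg_left (by linarith [le_abs_self (f i x - f i y)]) (by linarith)
    choose ε hε h using this
    cases nonempty_fintype ι
    rcases isEmpty_or_nonempty ι with hι | hι
    · exact ⟨1, one_pos, fun i => (hι.false i).elim⟩
    · obtain ⟨j, -, hj⟩ := Finset.exists_min_image Finset.univ ε Finset.univ_nonempty
      refine ⟨ε j, hε j, fun i => ?_⟩
      rcases le_total 0 (f i x - f i y) with h0 | h0
      · exact (mul_le_mul_of_nonneg_right (hj i (Finset.mem_univ i)) h0).trans (h i)
      · exact (mul_nonpos_of_nonneg_of_nonpos (hε j).le h0).trans (by linarith [hxS i])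
  have hz : x + ε • (x - y) ∈ {x | ∀ i, f i x ≤ b i} := by
    intro i
    simp only [map_add, map_smul, map_sub, smul_eq_mul]
    linarith [h i]
  have hseg : x ∈ openSegment ℝ y (x + ε • (x - y)) := by
    refine ⟨ε / (1 + ε), 1 / (1 + ε), by positivity, by positivity, by field_simp; ring, ?_⟩
    rw [smul_add, smul_smul, smul_sub, one_div_mul_eq_div]
    have : x = (1 / (1 + ε) + ε / (1 + ε)) • x := by
      rw [← add_div, div_self (by positivity), one_smul]
    nth_rw 3 [this]
    rw [add_smul]
    abel
  exact (hx.2 hyS hz hseg).symm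

/-- A closed convex body that is a finite union of closed sets is the union of those among them
that have nonempty interior. -/
theorem Convex.subset_iUnion_nonempty_interior [FiniteDimensional ℝ E] {ι : Type*} [Finite ι]
    {K : Set E} (hK : Convex ℝ K) (hint : (interior K).Nonempty)
    {A : ι → Set E} (hA : ∀ i, IsClosed (A i)) (hKA : K ⊆ ⋃ i, A i) :
    K ⊆ ⋃ i : {i // (interior (A i)).Nonempty}, A i := by
  have : CompleteSpace E := FiniteDimensional.complete ℝ E
  have hd : Dense (⋂ i : {i // ¬ (interior (A i)).Nonempty}, (A i)ᶜ) := by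
    refine dense_iInter_of_isOpen (fun i => (hA i).isOpen_compl) fun i => ?_
    rw [← interior_eq_empty_iff_dense_compl]
    exact not_nonempty_iff_eq_empty.1 i.2
  have hU : IsClosed (⋃ i : {i // (interior (A i)).Nonempty}, A i) :=
    isClosed_iUnion_of_finite fun i => hA i
  have h1 : K ⊆ closure (interior K) := by
    rw [hK.closure_interior_eq_closure_of_nonempty_interior hint]
    exact subset_closure
  refine h1.trans ((closure_minimal (hd.open_subset_closure_inter isOpen_interior)
    isClosed_closure).trans (closure_minimal ?_ hU))
  rintro x ⟨hx, hx'⟩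
  obtain ⟨i, hi⟩ := mem_iUnion.1 (hKA (interior_subset hx))
  by_cases h : (interior (A i)).Nonempty
  · exact mem_iUnion.2 ⟨⟨i, h⟩, hi⟩
  · exact absurd hi (mem_iInter.1 hx' ⟨i, h⟩)

end Polyhedra

/-- By Krein–Milman a compact polyhedron is the convex hull of its finitely many extreme points;
by Carathéodory it is the union of the simplices spanned by them, and those of lower dimension
can be dropped. -/
theorem IsPolyhedron.isPolytope {n : ℕ} {K : Set (EuclideanSpace ℝ (Fin n))}
    (hK : IsPolyhedron K) (hc : IsCompact K) (hint : (interior K).Nonempty) : IsPolytope K := by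
  classical
  set V := K.extremePoints ℝ with hV
  have hfin : V.Finite := hK.finite_extremePoints
  have hKV : convexHull ℝ V = K := by
    rw [← closure_convexHull_extremePoints hc hK.convex, (hfin.isClosed_convexHull ℝ).closure_eq]
  let ι := {t : Finset (EuclideanSpace ℝ (Fin n)) //
    (t : Set (EuclideanSpace ℝ (Fin n))) ⊆ V ∧
      AffineIndependent ℝ ((↑) : t → EuclideanSpace ℝ (Fin n))}
  have : Finite ι := by
    refine Set.Finite.subset (hfin.toFinset.powerset.finite_toSet) ?_
    rintro t ⟨ht, -⟩
    simpa [Finset.subset_iff] using ht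
  let A : ι → Set (EuclideanSpace ℝ (Fin n)) := fun t =>
    convexHull ℝ (t.1 : Set (EuclideanSpace ℝ (Fin n)))
  have hsub := hK.convex.subset_iUnion_nonempty_interior hint (A := A)
    (fun t => t.1.finite_toSet.isClosed_convexHull ℝ) (by
      rw [← hKV, convexHull_eq_union]
      intro x hx
      simp only [mem_iUnion] at hx ⊢
      obtain ⟨t, h1, h2, h3⟩ := hx
      exact ⟨⟨t, h1, h2⟩, h3⟩)
  have hsub' : ∀ t, A t ⊆ K := fun t => by
    rw [← hKV]
    exact convexHull_mono t.2.1
  have hsimplex : ∀ t : {t : ι // (interior (A t)).Nonempty},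
      ∃ s : Affine.Simplex ℝ (EuclideanSpace ℝ (Fin n)) n,
        convexHull ℝ (range s.points) = A t := by
    rintro ⟨⟨t, h1, h2⟩, h3⟩
    have h4 := interior_convexHull_nonempty_iff_affineSpan_eq_top.1 h3
    have h5 := (h2.affineSpan_eq_top_iff_card_eq_finrank_add_one).1 (by simpa using h4)
    rw [finrank_euclideanSpace, Fintype.card_fin, Fintype.card_coe] at h5
    let e : Fin (n + 1) ≃ t := (t.equivFinOfCardEq h5).symm
    refine ⟨⟨fun i => (e i : EuclideanSpace ℝ (Fin n)), h2.comp_embedding e.toEmbedding⟩, ?_⟩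
    have : range (fun i => (e i : EuclideanSpace ℝ (Fin n))) = t := by
      change range (Subtype.val ∘ e) = _
      rw [e.surjective.range_comp]
      simp
    simp only [this, A]
  choose s hs using hsimplex
  cases nonempty_fintype {t : ι // (interior (A t)).Nonempty}
  let e := (Fintype.equivFin {t : ι // (interior (A t)).Nonempty}).symm
  refine ⟨Fintype.card {t : ι // (interior (A t)).Nonempty}, ?_, fun j => s (e j), ?_⟩
  · obtain ⟨x, hx⟩ := hint
    obtain ⟨i, -⟩ := mem_iUnion.1 (hsub (interior_subset hx))
    exact Fintype.card_pos_iff.2 ⟨i⟩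
  · simp only [hs]
    rw [e.surjective.iUnion_comp (fun t : {t : ι // (interior (A t)).Nonempty} => A t)]
    exact hsub.antisymm (iUnion_subset fun t => hsub' t)

/-! ### Scissors congruence by polyhedral pieces -/

/-- `P` and `Q` are dissected into polyhedral pieces, indexed by `ι`, that correspond to each other
under isometries. The pieces may overlap in sets of empty interior and may themselves have empty
interior; allowing the latter makes the relation transitive without any case distinction. -/
def ScissorsCongruent {E : Type*} [NormedAddCommGroup E] [NormedSpace ℝ E] (ι : Type)
    (P Q : Set E) : Prop :=
  ∃ (A : ι → Set E) (g : ι → E ≃ᵢ E),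
    (∀ i, IsPolyhedron (A i)) ∧
    (∀ i j, i ≠ j → interior (A i ∩ A j) = ∅) ∧
    (∀ i j, i ≠ j → interior (g i '' A i ∩ g j '' A j) = ∅) ∧
    P = ⋃ i, A i ∧ Q = ⋃ i, g i '' A i

theorem IsometryEquiv.interior_image {E F : Type*} [PseudoEMetricSpace E] [PseudoEMetricSpace F]
    (g : E ≃ᵢ F) (s : Set E) : interior (g '' s) = g '' interior s :=
  (g.toHomeomorph.image_interior s).symm

section

variable {E : Type*} [NormedAddCommGroup E] [NormedSpace ℝ E] {ι κ : Type} {P Q R : Set E}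

theorem scissorsCongruent_image (hP : IsPolyhedron P) (g : E ≃ᵢ E) :
    ScissorsCongruent Unit P (g '' P) :=
  ⟨fun _ => P, fun _ => g, fun _ => hP, fun _ _ h => (h rfl).elim, fun _ _ h => (h rfl).elim,
    (iUnion_const P).symm, (iUnion_const _).symm⟩

/-- The pieces of the composite are the sets `A i ∩ (g i)⁻¹ (C j)`. -/
theorem ScissorsCongruent.trans (h₁ : ScissorsCongruent ι P Q) (h₂ : ScissorsCongruent κ Q R) :
    ScissorsCongruent (ι × κ) P R := by
  obtain ⟨A, g, hA, hAd, hAg, rfl, rfl⟩ := h₁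
  obtain ⟨C, h, hC, hCd, hCh, hQ, rfl⟩ := h₂
  have himg : ∀ p : ι × κ, ((g p.1).trans (h p.2)) '' (A p.1 ∩ g p.1 ⁻¹' C p.2) =
      h p.2 '' (g p.1 '' A p.1 ∩ C p.2) := by
    intro p
    change (h p.2 ∘ g p.1) '' _ = _
    rw [image_comp, image_inter_preimage]
  refine ⟨fun p => A p.1 ∩ g p.1 ⁻¹' C p.2, fun p => (g p.1).trans (h p.2),
    fun p => (hA _).inter ((hC _).preimage_isometryEquiv _), ?_, ?_, ?_, ?_⟩
  · rintro ⟨i, j⟩ ⟨i', j'⟩ hne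
    by_cases hi : i = i'
    · subst hi
      have hj : j ≠ j' := fun hj => hne (by rw [hj])
      have hsub : interior ((A i ∩ g i ⁻¹' C j) ∩ (A i ∩ g i ⁻¹' C j')) ⊆
          g i ⁻¹' interior (C j ∩ C j') := by
        refine (interior_mono ?_).trans ((g i).toHomeomorph.preimage_interior _).superset
        rintro x ⟨⟨-, h1⟩, -, h2⟩
        exact ⟨h1, h2⟩
      rw [hCd j j' hj, preimage_empty] at hsub
      exact subset_empty_iff.1 hsub
    · exact subset_empty_iff.1 ((interior_mono
        (inter_subset_inter inter_subset_left inter_subset_left)).trans (hAd i i' hi).subset)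
  · rintro ⟨i, j⟩ ⟨i', j'⟩ hne
    rw [himg, himg]
    by_cases hj : j = j'
    · subst hj
      have hi : i ≠ i' := fun hi => hne (by rw [hi])
      rw [← image_inter (h j).injective, IsometryEquiv.interior_image]
      have : interior ((g i '' A i ∩ C j) ∩ (g i' '' A i' ∩ C j)) = ∅ :=
        subset_empty_iff.1 ((interior_mono
          (inter_subset_inter inter_subset_left inter_subset_left)).trans (hAg i i' hi).subset)
      rw [this, image_empty]
    · refine subset_empty_iff.1 ((interior_mono (inter_subset_inter ?_ ?_)).trans
        (hCh j j' hj).subset)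
      · exact image_mono inter_subset_right
      · exact image_mono inter_subset_right
  · refine subset_antisymm (iUnion_subset fun i x hx => ?_)
      (iUnion_subset fun p x hx => mem_iUnion.2 ⟨p.1, hx.1⟩)
    have : g i x ∈ ⋃ j, C j := hQ ▸ mem_iUnion.2 ⟨i, x, hx, rfl⟩
    obtain ⟨j, hj⟩ := mem_iUnion.1 this
    exact mem_iUnion.2 ⟨(i, j), hx, hj⟩
  · simp only [himg]
    refine subset_antisymm (iUnion_subset fun j => ?_)
      (iUnion_subset fun p => subset_iUnion_of_subset p.2 (image_mono inter_subset_right))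
    rintro _ ⟨x, hx, rfl⟩
    have : x ∈ ⋃ i, g i '' A i := hQ ▸ mem_iUnion.2 ⟨j, hx⟩
    obtain ⟨i, hi⟩ := mem_iUnion.1 this
    exact mem_iUnion.2 ⟨(i, j), x, ⟨hi, hx⟩, rfl⟩

end

/-- Pieces of empty interior are superfluous in a dissection of convex bodies. -/
theorem ScissorsCongruent.equidissectableWith {n : ℕ} {ι : Type} [Fintype ι]
    {P Q : Set (EuclideanSpace ℝ (Fin n))} (h : ScissorsCongruent ι P Q) (hP : Convex ℝ P)
    (hPc : IsCompact P) (hint : (interior P).Nonempty) (hQ : Convex ℝ Q) :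
    ∃ k ≤ Fintype.card ι, EquidissectableWith k P Q := by
  classical
  obtain ⟨A, g, hA, hAd, hAg, hPA, hQA⟩ := h
  let κ := {i // (interior (A i)).Nonempty}
  have hAP : ∀ i, A i ⊆ P := fun i => hPA ▸ subset_iUnion A i
  have hsubP := hP.subset_iUnion_nonempty_interior hint (fun i => (hA i).isClosed) hPA.subset
  have hκ : Nonempty κ := by
    obtain ⟨x, hx⟩ := hint
    obtain ⟨i, -⟩ := mem_iUnion.1 (hsubP (interior_subset hx))
    exact ⟨i⟩
  have hgint : ∀ i, (interior (g i '' A i)).Nonempty ↔ (interior (A i)).Nonempty := fun i => by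
    rw [IsometryEquiv.interior_image, image_nonempty]
  have hQint : (interior Q).Nonempty := by
    obtain ⟨i, hi⟩ := hκ
    refine ((hgint i).2 hi).mono (interior_mono ?_)
    rw [hQA]
    exact subset_iUnion (fun i => g i '' A i) i
  have hsubQ := hQ.subset_iUnion_nonempty_interior hQint
    (fun i => ((hA i).image_isometryEquiv (g i)).isClosed) hQA.subset
  have hcA : ∀ i, IsCompact (A i) := fun i => hPc.of_isClosed_subset (hA i).isClosed (hAP i)
  let e : Fin (Fintype.card κ) ≃ κ := (Fintype.equivFin κ).symm
  have hne : ∀ i j, i ≠ j → (e i : ι) ≠ e j := fun i j hij h =>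
    hij (e.injective (Subtype.ext h))
  refine ⟨Fintype.card κ, Fintype.card_subtype_le _, Fintype.card_pos, fun i => A (e i),
    fun i => g (e i) '' A (e i), ⟨fun i => ?_, fun i j hij => ?_, ?_⟩,
    ⟨fun i => ?_, fun i j hij => ?_, ?_⟩, fun i => ⟨g (e i), rfl⟩⟩
  · exact (hA _).isPolytope (hcA _) (e i).2
  · rw [disjoint_iff_inter_eq_empty, ← interior_inter]
    exact hAd _ _ (hne i j hij)
  · rw [e.surjective.iUnion_comp (fun i : κ => A i)]
    exact hsubP.antisymm (iUnion_subset fun i => hAP i)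
  · exact ((hA _).image_isometryEquiv _).isPolytope ((hcA _).image (g _).continuous)
      ((hgint _).2 (e i).2)
  · rw [disjoint_iff_inter_eq_empty, ← interior_inter]
    exact hAg _ _ (hne i j hij)
  · rw [e.surjective.iUnion_comp (fun i : κ => g i '' A i)]
    refine Subset.antisymm (fun x hx => ?_) ?_
    · obtain ⟨⟨i, hi⟩, hx⟩ := mem_iUnion.1 (hsubQ hx)
      exact mem_iUnion.2 ⟨⟨i, (hgint i).1 hi⟩, hx⟩
    · rw [hQA]
      exact iUnion_subset fun i => subset_iUnion (fun i => g i '' A i) i.1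

/-! ### Cylinders -/

namespace EuclideanSpace

variable {n : ℕ}

/-- The point of `ℝⁿ⁺¹` whose first `n` coordinates are those of `x`, followed by `t`. -/
def snoc (x : EuclideanSpace ℝ (Fin n)) (t : ℝ) : EuclideanSpace ℝ (Fin (n + 1)) :=
  WithLp.toLp 2 (Fin.snoc (α := fun _ => ℝ) x t)

/-- The projection `ℝⁿ⁺¹ → ℝⁿ` to the first `n` coordinates. -/
def init : EuclideanSpace ℝ (Fin (n + 1)) →ₗ[ℝ] EuclideanSpace ℝ (Fin n) where
  toFun x := WithLp.toLp 2 fun i => x i.castSucc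
  map_add' _ _ := rfl
  map_smul' _ _ := rfl

@[simp] theorem init_apply (x : EuclideanSpace ℝ (Fin (n + 1))) (i : Fin n) :
    init x i = x i.castSucc := rfl

@[simp] theorem snoc_castSucc (x : EuclideanSpace ℝ (Fin n)) (t : ℝ) (i : Fin n) :
    snoc x t i.castSucc = x i := Fin.snoc_castSucc (α := fun _ => ℝ) ..

@[simp] theorem snoc_last (x : EuclideanSpace ℝ (Fin n)) (t : ℝ) :
    snoc x t (Fin.last n) = t := Fin.snoc_last (α := fun _ => ℝ) ..

@[simp] theorem init_snoc (x : EuclideanSpace ℝ (Fin n)) (t : ℝ) : init (snoc x t) = x := by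
  ext i; simp

theorem ext_init_last {x y : EuclideanSpace ℝ (Fin (n + 1))} (h : init x = init y)
    (hl : x (Fin.last n) = y (Fin.last n)) : x = y := by
  ext i
  induction i using Fin.lastCases with
  | last => exact hl
  | cast i => exact congrArg (fun z : EuclideanSpace ℝ (Fin n) => z i) h

@[simp] theorem snoc_init (x : EuclideanSpace ℝ (Fin (n + 1))) :
    snoc (init x) (x (Fin.last n)) = x := ext_init_last (by simp) (by simp)

theorem inner_snoc (x y : EuclideanSpace ℝ (Fin n)) (s t : ℝ) :
    inner ℝ (snoc x s) (snoc y t) = inner ℝ x y + s * t := by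
  simp [PiLp.inner_apply, Fin.sum_univ_castSucc, mul_comm]

theorem dist_sq_eq_init_add_last (x y : EuclideanSpace ℝ (Fin (n + 1))) :
    dist x y ^ 2 = dist (init x) (init y) ^ 2 + dist (x (Fin.last n)) (y (Fin.last n)) ^ 2 := by
  rw [EuclideanSpace.dist_eq, EuclideanSpace.dist_eq, Real.sq_sqrt (by positivity),
    Real.sq_sqrt (by positivity), Fin.sum_univ_castSucc]
  simp

/-- The isometry `(x, t) ↦ (g x, t)` of `ℝⁿ⁺¹`. -/
noncomputable def snocIsometry (g : EuclideanSpace ℝ (Fin n) ≃ᵢ EuclideanSpace ℝ (Fin n)) :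
    EuclideanSpace ℝ (Fin (n + 1)) ≃ᵢ EuclideanSpace ℝ (Fin (n + 1)) :=
  IsometryEquiv.mk' (fun x => snoc (g (init x)) (x (Fin.last n)))
    (fun x => snoc (g.symm (init x)) (x (Fin.last n))) (fun x => by simp)
    (Isometry.of_dist_eq fun x y => by
      rw [← sq_eq_sq₀ dist_nonneg dist_nonneg, dist_sq_eq_init_add_last,
        dist_sq_eq_init_add_last x y]
      simp [g.isometry.dist_eq])

theorem snocIsometry_apply (g : EuclideanSpace ℝ (Fin n) ≃ᵢ EuclideanSpace ℝ (Fin n))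
    (x : EuclideanSpace ℝ (Fin (n + 1))) :
    snocIsometry g x = snoc (g (init x)) (x (Fin.last n)) := rfl

theorem continuous_snoc (t : ℝ) : Continuous fun x : EuclideanSpace ℝ (Fin n) => snoc x t := by
  refine (PiLp.continuous_toLp 2 _).comp (continuous_pi fun i => ?_)
  induction i using Fin.lastCases with
  | last => simpa using continuous_const
  | cast i => simpa using (EuclideanSpace.proj (𝕜 := ℝ) i).continuous

/-- The cylinder `S × [0, l]`. -/
def cylinder (S : Set (EuclideanSpace ℝ (Fin n))) (l : ℝ) :
    Set (EuclideanSpace ℝ (Fin (n + 1))) :=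
  {x | init x ∈ S ∧ 0 ≤ x (Fin.last n) ∧ x (Fin.last n) ≤ l}

theorem isPolyhedron_cylinder {S : Set (EuclideanSpace ℝ (Fin n))} (hS : IsPolyhedron S) (l : ℝ) :
    IsPolyhedron (cylinder S l) := by
  let f : EuclideanSpace ℝ (Fin (n + 1)) →ₗ[ℝ] ℝ :=
    (EuclideanSpace.proj (Fin.last n) : EuclideanSpace ℝ (Fin (n + 1)) →L[ℝ] ℝ)
  exact (hS.preimage init.toAffineMap).inter
    ((isPolyhedron_halfSpace_ge f 0).inter (isPolyhedron_halfSpace f l))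

theorem interior_cylinder_inter {S T : Set (EuclideanSpace ℝ (Fin n))} (l : ℝ)
    (h : interior (S ∩ T) = ∅) : interior (cylinder S l ∩ cylinder T l) = ∅ := by
  by_contra hne
  obtain ⟨p, hp⟩ := nonempty_iff_ne_empty.2 hne
  have hsub : (fun x => snoc x (p (Fin.last n))) ⁻¹' interior (cylinder S l ∩ cylinder T l) ⊆
      interior (S ∩ T) := by
    refine interior_maximal (fun x hx => ?_) (isOpen_interior.preimage (continuous_snoc _))
    have := interior_subset hx
    simpa using (⟨this.1.1, this.2.1⟩ : _ ∧ _)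
  rw [h] at hsub
  exact hsub (a := init p) (by simpa using hp)

theorem snocIsometry_image_cylinder (g : EuclideanSpace ℝ (Fin n) ≃ᵢ EuclideanSpace ℝ (Fin n))
    (S : Set (EuclideanSpace ℝ (Fin n))) (l : ℝ) :
    snocIsometry g '' cylinder S l = cylinder (g '' S) l := by
  ext x
  constructor
  · rintro ⟨x, ⟨h1, h2⟩, rfl⟩
    rw [snocIsometry_apply]
    exact ⟨by simpa using h1, by simpa using h2⟩
  · rintro ⟨⟨y, hy, hyx⟩, h⟩
    refine ⟨snoc y (x (Fin.last n)), ⟨by simpa using hy, by simpa using h⟩, ?_⟩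
    simp [snocIsometry_apply, hyx]

theorem cylinder_iUnion {ι : Type*} (A : ι → Set (EuclideanSpace ℝ (Fin n))) (l : ℝ) :
    cylinder (⋃ i, A i) l = ⋃ i, cylinder (A i) l := by
  ext x
  simp [cylinder]

theorem _root_.ScissorsCongruent.cylinder {ι : Type} {P Q : Set (EuclideanSpace ℝ (Fin n))}
    (h : ScissorsCongruent ι P Q) (l : ℝ) :
    ScissorsCongruent ι (cylinder P l) (cylinder Q l) := by
  obtain ⟨A, g, hA, hAd, hAg, rfl, rfl⟩ := h
  refine ⟨fun i => EuclideanSpace.cylinder (A i) l, fun i => snocIsometry (g i),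
    fun i => isPolyhedron_cylinder (hA i) l, fun i j hij => interior_cylinder_inter l (hAd i j hij),
    fun i j hij => ?_, cylinder_iUnion A l, ?_⟩
  · rw [snocIsometry_image_cylinder, snocIsometry_image_cylinder]
    exact interior_cylinder_inter l (hAg i j hij)
  · simp only [snocIsometry_image_cylinder]
    exact cylinder_iUnion _ l

end EuclideanSpace

/-! ### Quasi-periodic sequences -/

section Rotation

variable {n : ℕ} (a : Fin (n + 1) → ℝ)

/-- The extension of `a 0, …, a n` to a sequence that drops by `1` over each period `n + 1`. -/
def periodicExt (m : ℕ) : ℝ := a (Fin.ofNat (n + 1) m) - (m / (n + 1) : ℕ)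

/-- The shift of the extended sequence: `(a 0, …, a n) ↦ (a 1, …, a n, a 0 - 1)`. -/
def rotate (i : Fin (n + 1)) : ℝ := periodicExt a (i + 1)

theorem periodicExt_val (i : Fin (n + 1)) : periodicExt a i = a i := by
  simp [periodicExt, Nat.div_eq_of_lt i.2]

theorem periodicExt_zero : periodicExt a 0 = a 0 := periodicExt_val a 0

theorem periodicExt_self : periodicExt a n = a (Fin.last n) := periodicExt_val a (Fin.last n)

theorem periodicExt_add_mul (m q : ℕ) :
    periodicExt a (m + q * (n + 1)) = periodicExt a m - q := by
  have h1 : Fin.ofNat (n + 1) (m + q * (n + 1)) = Fin.ofNat (n + 1) m := by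
    ext; simp
  have h2 : (m + q * (n + 1)) / (n + 1) = m / (n + 1) + q := Nat.add_mul_div_right _ _ n.succ_pos
  rw [periodicExt, periodicExt, h1, h2]
  push_cast
  ring

theorem periodicExt_add (m : ℕ) : periodicExt a (m + (n + 1)) = periodicExt a m - 1 := by
  simpa using periodicExt_add_mul a m 1

theorem periodicExt_succ_self : periodicExt a (n + 1) = a 0 - 1 := by
  rw [← periodicExt_zero a, ← periodicExt_add, zero_add]

theorem periodicExt_rotate (m : ℕ) : periodicExt (rotate a) m = periodicExt a (m + 1) := by
  have h : m = (m % (n + 1)) + (m / (n + 1)) * (n + 1) := (Nat.mod_add_div' m (n + 1)).symm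
  conv_rhs => rw [h, add_right_comm, periodicExt_add_mul]
  rfl

theorem sum_rotate : ∑ i, rotate a i = ∑ i, a i - 1 := by
  have h1 : ∑ i, rotate a i = ∑ m ∈ Finset.range (n + 1), periodicExt a (m + 1) :=
    (Finset.sum_range fun m => periodicExt a (m + 1)).symm
  have h2 : ∑ i, a i = ∑ m ∈ Finset.range (n + 1), periodicExt a m := by
    rw [Finset.sum_range]
    simp only [periodicExt_val]
  have h3 := Finset.sum_range_succ' (periodicExt a) (n + 1)
  rw [Finset.sum_range_succ, periodicExt_succ_self, periodicExt_zero] at h3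
  rw [h1, h2]
  linarith

theorem rotate_eq (i : Fin (n + 1)) :
    rotate a i = a (i + 1) - if i = Fin.last n then 1 else 0 := by
  split_ifs with h
  · subst h
    simp [rotate, periodicExt_succ_self]
  · have hi : (i : ℕ) + 1 = (i + 1 : Fin (n + 1)) := (Fin.val_add_one_of_lt
      (Fin.lt_last_iff_ne_last.2 h)).symm
    rw [rotate, hi, periodicExt_val, sub_zero]

theorem antitone_periodicExt_iff :
    Antitone (periodicExt a) ↔ Antitone a ∧ a 0 - 1 ≤ a (Fin.last n) := by
  constructor
  · intro h
    refine ⟨fun i j hij => ?_, ?_⟩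
    · simpa only [periodicExt_val] using h (Fin.le_def.1 hij)
    · rw [← periodicExt_succ_self a, ← periodicExt_self a]
      exact h n.le_succ
  · rintro ⟨h, h'⟩
    refine antitone_nat_of_succ_le fun m => ?_
    have hm : m = (m % (n + 1)) + (m / (n + 1)) * (n + 1) := (Nat.mod_add_div' m (n + 1)).symm
    have hr : m % (n + 1) < n + 1 := Nat.mod_lt _ n.succ_pos
    generalize m / (n + 1) = q at hm
    generalize m % (n + 1) = r at hm hr
    subst hm
    rw [add_right_comm, periodicExt_add_mul, periodicExt_add_mul]
    rcases (Nat.lt_succ_iff.1 hr).eq_or_lt with rfl | hr'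
    · rw [periodicExt_succ_self, periodicExt_self]
      linarith
    · have h1 := periodicExt_val a ⟨r, hr⟩
      have h2 := periodicExt_val a ⟨r + 1, by omega⟩
      simp only at h1 h2
      rw [h1, h2]
      exact sub_le_sub_right (h (Fin.mk_le_mk.2 r.le_succ)) _

/-- In terms of the extended sequence, the Hill simplex consists of the decreasing sequences that
change sign between the indices `n` and `n + 1`. -/
theorem antitone_mem_Icc_iff_periodicExt :
    (Antitone a ∧ ∀ i, 0 ≤ a i ∧ a i ≤ 1) ↔
      Antitone (periodicExt a) ∧ 0 ≤ periodicExt a n ∧ periodicExt a (n + 1) ≤ 0 := by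
  rw [antitone_periodicExt_iff, periodicExt_self, periodicExt_succ_self]
  constructor
  · rintro ⟨h, h'⟩
    exact ⟨⟨h, by linarith [(h' 0).2, (h' (Fin.last n)).1]⟩, (h' _).1, by linarith [(h' 0).2]⟩
  · rintro ⟨⟨h, -⟩, h0, h1⟩
    exact ⟨h, fun i => ⟨h0.trans (h (Fin.le_last i)), (h (Fin.zero_le i)).trans (by linarith)⟩⟩

/-- Every point of the slab `0 ≤ ∑ a i ≤ 1` of the infinite prism lies in one of the rearranged
slices, which are indexed by the place of the sign change. -/
theorem exists_periodicExt_sign_change (h : Antitone (periodicExt a)) (h0 : 0 ≤ ∑ i, a i)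
    (h1 : ∑ i, a i ≤ 1) :
    ∃ m ≤ n, 0 ≤ periodicExt a m ∧ periodicExt a (m + 1) ≤ 0 := by
  obtain ⟨ha, hl⟩ := (antitone_periodicExt_iff a).1 h
  have hfirst : 0 ≤ a 0 := by
    by_contra! hneg
    have : ∑ i, a i < 0 := Finset.sum_neg (fun i _ => (ha (Fin.zero_le i)).trans_lt hneg)
      Finset.univ_nonempty
    linarith
  have hle : a 0 ≤ 1 := by
    by_contra! hgt
    have : a 0 ≤ ∑ i, a i := Finset.single_le_sum
      (fun i _ => (by linarith [ha (Fin.le_last i)] : 0 ≤ a i)) (Finset.mem_univ 0)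
    linarith
  have hex : ∃ m, periodicExt a (m + 1) ≤ 0 := ⟨n, by rw [periodicExt_succ_self]; linarith⟩
  classical
  refine ⟨Nat.find hex, Nat.find_min' hex (by rw [periodicExt_succ_self]; linarith), ?_,
    Nat.find_spec hex⟩
  rcases Nat.eq_zero_or_pos (Nat.find hex) with hz | hpos
  · rw [hz, periodicExt_zero]
    exact hfirst
  · have := Nat.find_min hex (Nat.sub_lt hpos one_pos)
    rw [show Nat.find hex - 1 + 1 = Nat.find hex by omega] at this
    exact (not_le.1 this).le

end Rotation

/-! ### Systems of vectors with constant Gram matrix entries -/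

/-- The Gram matrix of `v` is `c • 1 - d • J`, where `J` is the all-ones matrix. -/
def HasGram {N : ℕ} {E : Type*} [NormedAddCommGroup E] [InnerProductSpace ℝ E] (c d : ℝ)
    (v : Fin N → E) : Prop :=
  ∀ i j, inner ℝ (v i) (v j) = (if i = j then c else 0) - d

section Gram

variable {N : ℕ} {E : Type*} [NormedAddCommGroup E] [InnerProductSpace ℝ E] {c d : ℝ}

theorem HasGram.inner_sum_smul {v : Fin N → E} (hv : HasGram c d v) (a : Fin N → ℝ) (j : Fin N) :
    inner ℝ (∑ i, a i • v i) (v j) = c * a j - d * ∑ i, a i := by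
  rw [HasGram] at hv
  simp only [sum_inner, real_inner_smul_left, hv, mul_sub, Finset.sum_sub_distrib, mul_ite,
    mul_zero, Finset.sum_ite_eq', Finset.mem_univ, if_true, ← Finset.sum_mul]
  ring

theorem HasGram.linearIndependent {v : Fin N → E} (hv : HasGram c d v) (hc : 0 < c)
    (hd : 0 < c - N * d) : LinearIndependent ℝ v := by
  rw [Fintype.linearIndependent_iff]
  intro a ha
  have h : ∀ j, c * a j - d * ∑ i, a i = 0 := fun j => by
    rw [← hv.inner_sum_smul, ha, inner_zero_left]
  have hs : (c - N * d) * ∑ i, a i = 0 := by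
    have := Finset.sum_eq_zero fun j (_ : j ∈ Finset.univ) => h j
    rw [Finset.sum_sub_distrib, ← Finset.mul_sum, Finset.sum_const, Finset.card_univ,
      Fintype.card_fin, nsmul_eq_mul] at this
    linarith
  have hs0 := (mul_eq_zero.1 hs).resolve_left hd.ne'
  intro i
  have := h i
  rw [hs0, mul_zero, sub_zero] at this
  exact (mul_eq_zero.1 this).resolve_left hc.ne'

theorem HasGram.exists_basis {v : Fin N → EuclideanSpace ℝ (Fin N)} (hv : HasGram c d v)
    (hc : 0 < c) (hd : 0 < c - N * d) :
    ∃ b : Module.Basis (Fin N) ℝ (EuclideanSpace ℝ (Fin N)), ⇑b = v := by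
  have hli := hv.linearIndependent hc hd
  rcases isEmpty_or_nonempty (Fin N) with hN | hN
  · obtain rfl : N = 0 := by
      by_contra h
      exact hN.false ⟨0, Nat.pos_of_ne_zero h⟩
    exact ⟨Module.Basis.empty _, Subsingleton.elim _ _⟩
  · exact ⟨basisOfLinearIndependentOfCardEqFinrank hli (by simp),
      coe_basisOfLinearIndependentOfCardEqFinrank hli _⟩

/-- Bases with equal Gram matrices correspond under a linear isometry. -/
theorem exists_linearIsometryEquiv_of_inner_eq (b b' : Module.Basis (Fin N) ℝ E)
    (h : ∀ i j, inner ℝ (b i) (b j) = inner ℝ (b' i) (b' j)) :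
    ∃ R : E ≃ₗᵢ[ℝ] E, ∀ x i, b'.repr (R x) i = b.repr x i := by
  have key : ∀ (e : Module.Basis (Fin N) ℝ E) (x y : E),
      inner ℝ x y = ∑ i, ∑ j, e.repr x i * (e.repr y j * inner ℝ (e i) (e j)) := by
    intro e x y
    conv_lhs => rw [← e.sum_repr x, ← e.sum_repr y]
    simp only [sum_inner, inner_sum, real_inner_smul_left, real_inner_smul_right]
    rw [Finset.sum_comm]
    exact Finset.sum_congr rfl fun i _ => Finset.sum_congr rfl fun j _ => by ring
  refine ⟨(b.repr.trans b'.repr.symm).isometryOfInner fun x y => ?_, fun x i => ?_⟩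
  · rw [key b' _ _, key b x y]
    simp [h]
  · simp

theorem mem_hillSimplex_basis (b : Module.Basis (Fin N) ℝ (EuclideanSpace ℝ (Fin N)))
    (x : EuclideanSpace ℝ (Fin N)) :
    x ∈ hillSimplex b ↔ Antitone (b.repr x) ∧ ∀ i, 0 ≤ b.repr x i ∧ b.repr x i ≤ 1 := by
  constructor
  · rintro ⟨a, ha, ha', rfl⟩
    rw [b.repr_sum_self]
    exact ⟨ha, ha'⟩
  · rintro ⟨h, h'⟩
    exact ⟨b.repr x, h, h', (b.sum_repr x).symm⟩

theorem isPolyhedron_hillSimplex (b : Module.Basis (Fin N) ℝ (EuclideanSpace ℝ (Fin N))) :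
    IsPolyhedron (hillSimplex b) := by
  have : hillSimplex b =
      (⋂ p : {p : Fin N × Fin N // p.1 ≤ p.2}, {x | (b.coord p.1.2 - b.coord p.1.1) x ≤ 0}) ∩
        ((⋂ i, {x | 0 ≤ b.coord i x}) ∩ ⋂ i, {x | b.coord i x ≤ 1}) := by
    ext x
    simp [mem_hillSimplex_basis, Antitone, forall_and, Subtype.forall, Prod.forall]
  rw [this]
  exact (isPolyhedron_iInter fun _ => isPolyhedron_halfSpace _ _).inter
    ((isPolyhedron_iInter fun _ => isPolyhedron_halfSpace_ge _ _).inter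
      (isPolyhedron_iInter fun _ => isPolyhedron_halfSpace _ _))

/-- Hill simplices with equal Gram matrices are congruent. -/
theorem scissorsCongruent_hillSimplex_of_inner_eq
    (b b' : Module.Basis (Fin N) ℝ (EuclideanSpace ℝ (Fin N)))
    (h : ∀ i j, inner ℝ (b i) (b j) = inner ℝ (b' i) (b' j)) :
    ScissorsCongruent Unit (hillSimplex b) (hillSimplex b') := by
  obtain ⟨R, hR⟩ := exists_linearIsometryEquiv_of_inner_eq b b' h
  have hR' : ∀ x, (b'.repr (R x) : Fin N → ℝ) = b.repr x := fun x => funext (hR x)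
  have : hillSimplex b' = R.toIsometryEquiv '' hillSimplex b := by
    ext y
    constructor
    · intro hy
      refine ⟨R.symm y, ?_, by simp⟩
      rw [mem_hillSimplex_basis, ← hR']
      rw [mem_hillSimplex_basis] at hy
      simpa using hy
    · rintro ⟨x, hx, rfl⟩
      rw [mem_hillSimplex_basis, ← hR'] at hx
      rw [mem_hillSimplex_basis]
      exact hx
  rw [this]
  exact scissorsCongruent_image (isPolyhedron_hillSimplex b) _

end Gram

/-! ### From a Hill simplex to a prism -/

section Prism

variable {n : ℕ} {c d : ℝ}

/-- The map `∑ a i • b i ↦ ∑ rotate a i • b i` is an isometry, because the Gram matrix of `b` is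
invariant under cyclic permutations. -/
theorem exists_isometryEquiv_rotate
    (b : Module.Basis (Fin (n + 1)) ℝ (EuclideanSpace ℝ (Fin (n + 1)))) (hb : HasGram c d b) :
    ∃ T : EuclideanSpace ℝ (Fin (n + 1)) ≃ᵢ EuclideanSpace ℝ (Fin (n + 1)),
      ∀ x, (b.repr (T x) : Fin (n + 1) → ℝ) = rotate (b.repr x) := by
  obtain ⟨R, hR⟩ := exists_linearIsometryEquiv_of_inner_eq b (b.reindex (Equiv.addRight 1))
    (fun i j => by
      rw [hb, Module.Basis.reindex_apply, Module.Basis.reindex_apply, hb]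
      simp)
  refine ⟨R.toIsometryEquiv.trans (IsometryEquiv.subRight (b (Fin.last n))), fun x => ?_⟩
  ext i
  have := hR x (i + 1)
  rw [Module.Basis.repr_reindex_apply] at this
  rw [rotate_eq, ← this]
  simp [Finsupp.single_apply, eq_comm]

/-- The points whose extended coordinate sequence is decreasing form an infinite prism, in
coordinates `a 0 ≥ ⋯ ≥ a n ≥ a 0 - 1`; this is its part between two parallel hyperplanes. -/
def hillPrism (b : Module.Basis (Fin (n + 1)) ℝ (EuclideanSpace ℝ (Fin (n + 1)))) :
    Set (EuclideanSpace ℝ (Fin (n + 1))) :=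
  {x | Antitone (periodicExt (b.repr x)) ∧ 0 ≤ ∑ i, b.repr x i ∧ ∑ i, b.repr x i ≤ 1}

theorem interior_hyperplane_eq_empty {E : Type*} [NormedAddCommGroup E] [NormedSpace ℝ E]
    {f : E →ₗ[ℝ] ℝ} (hf : f ≠ 0) (r : ℝ) : interior {x | f x = r} = ∅ := by
  by_contra hne
  obtain ⟨x, hx⟩ := nonempty_iff_ne_empty.2 hne
  obtain ⟨v, hv⟩ : ∃ v, f v ≠ 0 := by
    by_contra! h
    exact hf (LinearMap.ext h)
  have hcont : ContinuousAt (fun t : ℝ => x + t • v) 0 := by fun_prop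
  have hev : ∀ᶠ t : ℝ in nhds 0, x + t • v ∈ {x | f x = r} :=
    hcont (by simpa using mem_interior_iff_mem_nhds.1 hx)
  have hev' : ∀ᶠ t : ℝ in nhdsWithin 0 {0}ᶜ, False := by
    filter_upwards [hev.filter_mono nhdsWithin_le_nhds, self_mem_nhdsWithin] with t ht ht0
    have hxr : x ∈ {x | f x = r} := interior_subset hx
    rw [mem_ofPred_eq] at hxr
    simp only [map_add, map_smul, smul_eq_mul, hxr, add_eq_left] at ht
    exact (mul_ne_zero ht0 hv) ht
  exact hev'.exists.elim fun _ h => h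

/-- Slicing the Hill simplex by the hyperplanes `∑ a i = j` gives `n + 1` slices, and the powers of
the isometry acting on coordinates by `rotate`, which lowers `∑ a i` by `1` and under which the infinite prism is invariant,
rearrange them to a slab of the prism. -/
theorem scissorsCongruent_hillSimplex_hillPrism
    (b : Module.Basis (Fin (n + 1)) ℝ (EuclideanSpace ℝ (Fin (n + 1)))) (hb : HasGram c d b) :
    ScissorsCongruent (Fin (n + 1)) (hillSimplex b) (hillPrism b) := by
  obtain ⟨T, hT⟩ := exists_isometryEquiv_rotate b hb
  have hpow : ∀ (j : ℕ) x m,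
      periodicExt (b.repr ((T ^ j) x)) m = periodicExt (b.repr x) (m + j) := by
    intro j
    induction j with
    | zero => intro x m; simp
    | succ j ih =>
      intro x m
      rw [pow_succ', IsometryEquiv.mul_apply, hT, periodicExt_rotate, ih]
      congr 1
      ring
  have hsum : ∀ (j : ℕ) x, ∑ i, b.repr ((T ^ j) x) i = ∑ i, b.repr x i - j := by
    intro j
    induction j with
    | zero => intro x; simp
    | succ j ih =>
      intro x
      rw [pow_succ', IsometryEquiv.mul_apply, hT, sum_rotate, ih]
      push_cast
      ring
  have hmem : ∀ x, x ∈ hillSimplex b ↔ Antitone (periodicExt (b.repr x)) ∧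
      0 ≤ periodicExt (b.repr x) n ∧ periodicExt (b.repr x) (n + 1) ≤ 0 := fun x => by
    rw [mem_hillSimplex_basis, antitone_mem_Icc_iff_periodicExt]
  let f : EuclideanSpace ℝ (Fin (n + 1)) →ₗ[ℝ] ℝ := ∑ i, b.coord i
  have hf : ∀ x, f x = ∑ i, b.repr x i := fun x => by simp [f]
  have hf0 : f ≠ 0 := fun h0 => by
    have := hf (b 0)
    simp [h0, Finsupp.single_apply] at this
  let A : Fin (n + 1) → Set (EuclideanSpace ℝ (Fin (n + 1))) := fun j =>
    hillSimplex b ∩ ({x | ((j : ℕ) : ℝ) ≤ f x} ∩ {x | f x ≤ ((j : ℕ) : ℝ) + 1})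
  -- In the original coordinates the sign change is at `n`; the power `T ^ j` shifts it to `n - j`.
  have himg : ∀ (j : Fin (n + 1)) y, y ∈ (T ^ (j : ℕ)) '' A j ↔
      y ∈ hillPrism b ∧ 0 ≤ periodicExt (b.repr y) (n - j) ∧
        periodicExt (b.repr y) (n - j + 1) ≤ 0 := by
    intro j y
    obtain ⟨x, rfl⟩ := (T ^ (j : ℕ)).surjective y
    rw [(T ^ (j : ℕ)).injective.mem_set_image]
    have hj : (j : ℕ) ≤ n := Nat.lt_succ_iff.1 j.2
    have hanti : Antitone (periodicExt (b.repr ((T ^ (j : ℕ)) x))) ↔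
        Antitone (periodicExt (b.repr x)) := by
      constructor
      -- One period is added to the indices, since a shift back by `j` may leave `ℕ`.
      · intro h k l hkl
        have := h (show k + (n + 1 - j) ≤ l + (n + 1 - j) by omega)
        rw [hpow, hpow] at this
        have e : ∀ k : ℕ, k + (n + 1 - j) + j = k + (n + 1) := fun k => by omega
        rw [e, e, periodicExt_add, periodicExt_add] at this
        linarith
      · intro h k l hkl
        rw [hpow, hpow]
        exact h (by omega)
    have e1 : n - j + j = n := by omega
    have e2 : n - j + 1 + j = n + 1 := by omega
    simp only [A, hillPrism, mem_inter_iff, mem_ofPred_eq, hmem, hf, hanti, hpow, hsum, e1, e2]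
    constructor
    · rintro ⟨⟨h1, h2, h3⟩, h4, h5⟩
      exact ⟨⟨h1, by linarith, by linarith⟩, h2, h3⟩
    · rintro ⟨⟨h1, h4, h5⟩, h2, h3⟩
      exact ⟨⟨h1, h2, h3⟩, by linarith, by linarith⟩
  have hdisj : ∀ i j : Fin (n + 1), i < j → interior (A i ∩ A j) = ∅ := by
    intro i j hij
    refine subset_empty_iff.1 ((interior_mono fun x hx => ?_).trans
      (interior_hyperplane_eq_empty hf0 (j : ℕ)).subset)
    have h1 : f x ≤ (i : ℕ) + 1 := hx.1.2.2
    have h2 : ((j : ℕ) : ℝ) ≤ f x := hx.2.2.1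
    have h3 : ((i : ℕ) : ℝ) + 1 ≤ (j : ℕ) := by exact_mod_cast hij
    exact le_antisymm (h1.trans h3) h2
  have hdisj' : ∀ i j : Fin (n + 1), i < j →
      interior ((T ^ (i : ℕ)) '' A i ∩ (T ^ (j : ℕ)) '' A j) = ∅ := by
    -- Two sign changes at different places force the coordinate with index `n - i` to vanish.
    intro i j hij
    have hcoord : b.coord i.rev ≠ 0 := fun h0 => by
      have : b.coord i.rev (b i.rev) = 1 := by simp
      simp [h0] at this
    refine subset_empty_iff.1 ((interior_mono fun x hx => ?_).trans
      (interior_hyperplane_eq_empty hcoord 0).subset)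
    obtain ⟨⟨hx', -⟩, h1, -⟩ := (himg i x).1 hx.1
    obtain ⟨-, -, h2⟩ := (himg j x).1 hx.2
    have hij' : (i : ℕ) < j := hij
    have hi : periodicExt (b.repr x) (n - i) = b.repr x i.rev := by
      rw [← periodicExt_val (b.repr x)]
      congr 1
      simp [Fin.val_rev]
    have h3 := hx' (show n - (j : ℕ) + 1 ≤ n - i by omega)
    rw [hi] at h1 h3
    exact le_antisymm (h3.trans h2) h1
  refine ⟨A, fun j => T ^ (j : ℕ), fun j => (isPolyhedron_hillSimplex b).inter
    ((isPolyhedron_halfSpace_ge _ _).inter (isPolyhedron_halfSpace _ _)), ?_, ?_, ?_, ?_⟩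
  · intro i j hij
    rcases hij.lt_or_gt with h | h
    · exact hdisj i j h
    · rw [inter_comm]
      exact hdisj j i h
  · intro i j hij
    rcases hij.lt_or_gt with h | h
    · exact hdisj' i j h
    · rw [inter_comm]
      exact hdisj' j i h
  · refine Subset.antisymm (fun x hx => ?_) (iUnion_subset fun j => inter_subset_left)
    have hx' := (mem_hillSimplex_basis b x).1 hx
    have h0 : 0 ≤ f x := by
      rw [hf]
      exact Finset.sum_nonneg fun i _ => (hx'.2 i).1
    have h1 : f x ≤ n + 1 := by
      rw [hf]
      refine (Finset.sum_le_sum fun i _ => (hx'.2 i).2).trans ?_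
      simp
    refine mem_iUnion.2 ⟨⟨min ⌊f x⌋₊ n, by omega⟩, hx, ?_, ?_⟩
    · refine le_trans ?_ (Nat.floor_le h0)
      simp
    · rcases le_total ⌊f x⌋₊ n with h | h
      · simpa [h] using (Nat.lt_floor_add_one (f x)).le
      · simpa [h] using h1
  · ext y
    rw [mem_iUnion]
    constructor
    · intro hy
      obtain ⟨m, hm, h1, h2⟩ := exists_periodicExt_sign_change _ hy.1 hy.2.1 hy.2.2
      refine ⟨⟨n - m, by omega⟩, (himg _ y).2 ⟨hy, ?_⟩⟩
      have e : n - (n - m) = m := by omega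
      simp only [e]
      exact ⟨h1, h2⟩
    · rintro ⟨j, hj⟩
      exact ((himg j y).1 hj).1

end Prism

section Prism

variable {n : ℕ} {c d : ℝ}

/-- The vectors `(v i, l)` together with `(-∑ v i, l)`. -/
noncomputable def hillLift (v : Fin n → EuclideanSpace ℝ (Fin n)) (l : ℝ) :
    Fin (n + 1) → EuclideanSpace ℝ (Fin (n + 1)) :=
  Fin.snoc (α := fun _ => EuclideanSpace ℝ (Fin (n + 1)))
    (fun i => EuclideanSpace.snoc (v i) l) (EuclideanSpace.snoc (-∑ i, v i) l)

theorem hillLift_castSucc (v : Fin n → EuclideanSpace ℝ (Fin n)) (l : ℝ) (i : Fin n) :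
    hillLift v l i.castSucc = EuclideanSpace.snoc (v i) l :=
  Fin.snoc_castSucc (α := fun _ => EuclideanSpace ℝ (Fin (n + 1))) ..

theorem hillLift_last (v : Fin n → EuclideanSpace ℝ (Fin n)) (l : ℝ) :
    hillLift v l (Fin.last n) = EuclideanSpace.snoc (-∑ i, v i) l :=
  Fin.snoc_last (α := fun _ => EuclideanSpace ℝ (Fin (n + 1))) ..

/-- Lifting by a height `l` adds `l ^ 2` to every entry of the Gram matrix of `v 1, …, v n, -∑ v i`,
which is `c • 1 - (c / (n + 1)) • J`; every matrix `c • 1 - d • J` that is positive definite arises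
in this way. -/
theorem HasGram.hillLift {v : Fin n → EuclideanSpace ℝ (Fin n)}
    (hv : HasGram c (c / (n + 1)) v) {l : ℝ} (hl : l ^ 2 = (c - (n + 1) * d) / (n + 1)) :
    HasGram c d (hillLift v l) := by
  have hn : (n : ℝ) + 1 ≠ 0 := by positivity
  have hs : ∀ j, inner ℝ (∑ i, v i) (v j) = c / (n + 1) := fun j => by
    have := hv.inner_sum_smul (fun _ => 1) j
    simp only [one_smul, Finset.sum_const, Finset.card_univ, Fintype.card_fin, nsmul_eq_mul] at this
    rw [this]
    field_simp
    ring
  have hss : inner ℝ (∑ i, v i) (∑ i, v i) = n * (c / (n + 1)) := by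
    rw [inner_sum]
    simp [hs]
  have hl' : l * l = (c - (n + 1) * d) / (n + 1) := by rw [← hl, sq]
  intro i j
  induction i using Fin.lastCases with
  | last =>
    induction j using Fin.lastCases with
    | last =>
      rw [hillLift_last, EuclideanSpace.inner_snoc, inner_neg_neg, hss, hl', if_pos rfl]
      field_simp
      ring
    | cast j =>
      rw [hillLift_last, hillLift_castSucc, EuclideanSpace.inner_snoc, inner_neg_left, hs, hl',
        if_neg (Fin.castSucc_lt_last j).ne']
      field_simp
      ring
  | cast i =>
    induction j using Fin.lastCases with
    | last =>
      rw [hillLift_last, hillLift_castSucc, EuclideanSpace.inner_snoc, inner_neg_right,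
        real_inner_comm, hs, hl', if_neg (Fin.castSucc_lt_last i).ne]
      field_simp
      ring
    | cast j =>
      rw [hillLift_castSucc, hillLift_castSucc, EuclideanSpace.inner_snoc, hv i j, hl']
      simp only [Fin.castSucc_inj]
      field_simp
      ring

/-- The lifts, iterated from dimension `0`, realize all these positive definite Gram matrices. -/
theorem exists_hasGram (N : ℕ) : ∀ c d : ℝ, 0 < c → 0 < c - N * d →
    ∃ v : Fin N → EuclideanSpace ℝ (Fin N), HasGram c d v := by
  induction N with
  | zero => exact fun c d _ _ => ⟨0, fun i => i.elim0⟩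
  | succ n ih =>
    intro c d hc hd
    push_cast at hd
    obtain ⟨v, hv⟩ := ih c (c / (n + 1)) hc (by
      have : c - n * (c / (n + 1)) = c / (n + 1) := by field_simp; ring
      rw [this]
      positivity)
    exact ⟨_, hv.hillLift (Real.sq_sqrt (by positivity : 0 ≤ (c - (n + 1) * d) / (n + 1)))⟩

/-- In suitable coordinates the slab of the infinite prism is a cylinder over a Hill simplex of
one dimension less. -/
theorem hillPrism_eq_cylinder (b' : Module.Basis (Fin n) ℝ (EuclideanSpace ℝ (Fin n)))
    (b : Module.Basis (Fin (n + 1)) ℝ (EuclideanSpace ℝ (Fin (n + 1)))) {l : ℝ} (hl : 0 < l)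
    (hb : ⇑b = hillLift b' l) :
    hillPrism b = EuclideanSpace.cylinder (hillSimplex b') l := by
  ext x
  have hx : x = ∑ i, b.repr x i • hillLift b' l i := by
    rw [← hb, b.sum_repr]
  have hlast : x (Fin.last n) = (∑ i, b.repr x i) * l := by
    have := congrArg (EuclideanSpace.proj (𝕜 := ℝ) (Fin.last n)) hx
    rw [map_sum] at this
    simpa [Fin.sum_univ_castSucc, hillLift_castSucc, hillLift_last, ← Finset.sum_mul, add_mul]
      using this
  have hinit : (b'.repr (EuclideanSpace.init x) : Fin n → ℝ) =
      fun i => b.repr x i.castSucc - b.repr x (Fin.last n) := by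
    have : EuclideanSpace.init x =
        ∑ i : Fin n, (b.repr x i.castSucc - b.repr x (Fin.last n)) • b' i := by
      have := congrArg EuclideanSpace.init hx
      rw [map_sum] at this
      simpa [Fin.sum_univ_castSucc, hillLift_castSucc, hillLift_last, sub_smul,
        Finset.smul_sum, ← sub_eq_add_neg] using this
    rw [this, b'.repr_sum_self]
  change _ ∧ _ ↔ _ ∧ _
  rw [mem_hillSimplex_basis, hinit, antitone_periodicExt_iff, hlast]
  refine and_congr ?_ (and_congr (by rw [mul_nonneg_iff_of_pos_right hl])
    (by rw [mul_le_iff_le_one_left hl]))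
  constructor
  · rintro ⟨h, h'⟩
    refine ⟨fun i j hij => sub_le_sub_right (h (Fin.castSucc_le_castSucc_iff.2 hij)) _,
      fun i => ⟨sub_nonneg.2 (h (Fin.le_last _)), ?_⟩⟩
    linarith [h (Fin.zero_le i.castSucc)]
  · rintro ⟨h, h'⟩
    refine ⟨fun i j hij => ?_, ?_⟩
    · induction j using Fin.lastCases with
      | last =>
        induction i using Fin.lastCases with
        | last => rfl
        | cast i => exact sub_nonneg.1 (h' i).1
      | cast j =>
        induction i using Fin.lastCases with
        | last => exact absurd (hij.trans_lt (Fin.castSucc_lt_last j)) (lt_irrefl _)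
        | cast i =>
          have := h (Fin.castSucc_le_castSucc_iff.1 hij)
          simp only at this
          linarith
    · cases n with
      | zero => simp
      | succ n =>
        have := (h' 0).2
        simp only [Fin.castSucc_zero] at this
        linarith

end Prism

/-! ### From the prism to the brick -/

theorem cylinder_brick {n : ℕ} (s : Fin (n + 1) → ℝ) :
    EuclideanSpace.cylinder (brick fun i : Fin n => s i.castSucc) (s (Fin.last n)) = brick s := by
  ext x
  simp [EuclideanSpace.cylinder, brick, Fin.forall_fin_succ']

/-- The side lengths of the brick attached to the Gram matrix `c • 1 - d • J`. -/
noncomputable def hillBrickSide (N : ℕ) (c d : ℝ) (i : Fin N) : ℝ :=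
  if (i : ℕ) + 1 < N then √c * brickP (i + 1) else √((c - N * d) / N)

/-- The shape parameter `c / (n + 1)` of the base of the prism makes the last side of its brick
equal to `√c * brickP n`. -/
theorem hillBrickSide_castSucc {n : ℕ} {c : ℝ} (hc : 0 < c) (d : ℝ) (i : Fin n) :
    hillBrickSide (n + 1) c d i.castSucc = hillBrickSide n c (c / (n + 1)) i := by
  have hi := i.2
  rw [hillBrickSide, hillBrickSide, Fin.val_castSucc, if_pos (by omega)]
  split_ifs with h
  · rfl
  · have hn : (i : ℕ) + 1 = n := by omega
    have hn0 : (0 : ℝ) < n := by exact_mod_cast (by omega : 0 < n)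
    rw [hn, brickP, mul_one_div, ← Real.sqrt_div hc.le]
    congr 1
    field_simp
    ring

/-- Each dimension contributes a factor `N` to the number of pieces. -/
theorem scissorsCongruent_hillSimplex_brick (N : ℕ) : ∀ (c d : ℝ), 0 < c → 0 < c - N * d →
    ∀ v : Fin N → EuclideanSpace ℝ (Fin N), HasGram c d v →
      ∃ (ι : Type) (_ : Fintype ι), Fintype.card ι = N.factorial ∧
        ScissorsCongruent ι (hillSimplex v) (brick (hillBrickSide N c d)) := by
  induction N with
  | zero =>
    intro c d _ _ v _
    refine ⟨Unit, inferInstance, rfl, ?_⟩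
    have h1 : hillSimplex v = univ := eq_univ_of_forall fun x =>
      ⟨0, fun i => i.elim0, fun i => i.elim0, Subsingleton.elim _ _⟩
    have h2 : brick (hillBrickSide 0 c d) = IsometryEquiv.refl _ '' univ := by
      ext x
      simp [brick]
    rw [h1, h2]
    exact scissorsCongruent_image isPolyhedron_univ _
  | succ n ih =>
    intro c d hc hd v hv
    have hd' : 0 < c - n * (c / (n + 1)) := by
      have : c - n * (c / (n + 1)) = c / (n + 1) := by field_simp; ring
      rw [this]
      positivity
    have hlpos : 0 < (c - (n + 1 : ℕ) * d) / (n + 1 : ℕ) := div_pos hd (by positivity)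
    obtain ⟨v', hv'⟩ := exists_hasGram n c (c / (n + 1)) hc hd'
    obtain ⟨b', rfl⟩ := hv'.exists_basis hc hd'
    obtain ⟨ι, _, hι, h⟩ := ih c (c / (n + 1)) hc hd' b' hv'
    have hlast : hillBrickSide (n + 1) c d (Fin.last n) =
        √((c - (n + 1 : ℕ) * d) / (n + 1 : ℕ)) := by
      simp [hillBrickSide]
    set l := hillBrickSide (n + 1) c d (Fin.last n)
    have hl0 : 0 < l := hlast ▸ Real.sqrt_pos.2 hlpos
    have hlift : HasGram c d (hillLift b' l) := hv'.hillLift (by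
      rw [hlast, Real.sq_sqrt hlpos.le]
      push_cast
      rfl)
    obtain ⟨b, rfl⟩ := hv.exists_basis hc hd
    obtain ⟨B, hB⟩ := hlift.exists_basis hc hd
    rw [← hB] at hlift
    have h₁ := scissorsCongruent_hillSimplex_of_inner_eq b B fun i j => by rw [hv i j, hlift i j]
    have h₂ := scissorsCongruent_hillSimplex_hillPrism B hlift
    have h₃ := h.cylinder l
    rw [← hillPrism_eq_cylinder b' B hl0 hB] at h₃
    have hbrick : EuclideanSpace.cylinder (brick (hillBrickSide n c (c / (n + 1)))) l =
        brick (hillBrickSide (n + 1) c d) := by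
      rw [← cylinder_brick]
      simp only [hillBrickSide_castSucc hc]
      rfl
    rw [hbrick] at h₃
    refine ⟨_, inferInstance, ?_, (h₁.trans h₂).trans h₃⟩
    simp [hι, Nat.factorial_succ]

/-! ### Passing to honest polytopes -/

theorem convex_brick {N : ℕ} (s : Fin N → ℝ) : Convex ℝ (brick s) := by
  intro x hx y hy a b ha hb hab i
  have h1 := hx i
  have h2 := hy i
  simp only [PiLp.add_apply, PiLp.smul_apply, smul_eq_mul]
  constructor
  · nlinarith
  · nlinarith

theorem isCompact_hillSimplex {N : ℕ} (v : Fin N → EuclideanSpace ℝ (Fin N)) :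
    IsCompact (hillSimplex v) := by
  have : hillSimplex v = (fun a : Fin N → ℝ => ∑ i, a i • v i) ''
      ({a | Antitone a} ∩ Icc 0 1) := by
    ext x
    constructor
    · rintro ⟨a, ha, h, rfl⟩
      exact ⟨a, ⟨ha, fun i => (h i).1, fun i => (h i).2⟩, rfl⟩
    · rintro ⟨a, ⟨ha, h0, h1⟩, rfl⟩
      exact ⟨a, ha, fun i => ⟨h0 i, h1 i⟩, rfl⟩
  rw [this]
  refine IsCompact.image (isCompact_Icc.inter_left ?_) (by fun_prop)
  simp only [Antitone, ofPred_forall]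
  exact isClosed_iInter fun i => isClosed_iInter fun j => isClosed_iInter fun _ =>
    isClosed_le (continuous_apply j) (continuous_apply i)

/-- The points with coordinates `1 > a 0 > ⋯ > a (N - 1) > 0` are interior. -/
theorem nonempty_interior_hillSimplex {N : ℕ}
    (b : Module.Basis (Fin N) ℝ (EuclideanSpace ℝ (Fin N))) :
    (interior (hillSimplex b)).Nonempty := by
  let a : Fin N → ℝ := fun i => 1 - ((i : ℕ) + 1 : ℝ) / (N + 1)
  let U : Set (EuclideanSpace ℝ (Fin N)) :=
    {x | (∀ i j, i < j → b.coord j x < b.coord i x) ∧ ∀ i, 0 < b.coord i x ∧ b.coord i x < 1}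
  have hc : ∀ i, Continuous (b.coord i) := fun i => (b.coord i).continuous_of_finiteDimensional
  have hU : IsOpen U := by
    simp only [U, ofPred_and, ofPred_forall]
    refine IsOpen.inter (isOpen_iInter_of_finite fun i => isOpen_iInter_of_finite fun j =>
      isOpen_iInter_of_finite fun _ => isOpen_lt (hc j) (hc i)) (isOpen_iInter_of_finite fun i =>
      (isOpen_lt continuous_const (hc i)).inter (isOpen_lt (hc i) continuous_const))
  refine ⟨∑ i, a i • b i, interior_maximal (fun x hx => ?_) hU ?_⟩
  · rw [mem_hillSimplex_basis]
    refine ⟨fun i j hij => ?_, fun i => ⟨(hx.2 i).1.le, (hx.2 i).2.le⟩⟩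
    rcases hij.eq_or_lt with rfl | h
    · rfl
    · exact (hx.1 i j h).le
  · have hN : (0 : ℝ) < N + 1 := by positivity
    have hcoord : ∀ i, b.coord i (∑ i, a i • b i) = a i := fun i => by
      rw [Module.Basis.coord_apply, b.repr_sum_self]
    refine ⟨fun i j hij => ?_, fun i => ?_⟩
    · rw [hcoord, hcoord]
      have : ((i : ℕ) : ℝ) < (j : ℕ) := by exact_mod_cast hij
      exact sub_lt_sub_left (div_lt_div_of_pos_right (by linarith) hN) _
    · rw [hcoord]
      have : ((i : ℕ) : ℝ) < N := by exact_mod_cast i.2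
      refine ⟨sub_pos.2 ((div_lt_one hN).2 (by linarith)), sub_lt_self _ (by positivity)⟩

theorem IsHillSystem.hasGram {n : ℕ} {w : ℝ} {v : Fin n → EuclideanSpace ℝ (Fin n)}
    (hv : IsHillSystem w v) : HasGram (1 + w) w v := by
  intro i j
  split_ifs with h
  · subst h
    rw [real_inner_self_eq_norm_sq, hv.norm_eq_one]
    ring
  · rw [hv.inner_eq i j h]
    ring

theorem IsHillSystem.exists_equidissectableWith_brick {n : ℕ} {w : ℝ}
    {v : Fin n → EuclideanSpace ℝ (Fin n)} (hv : IsHillSystem w v) (hw : -1 < w)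
    (hw' : w * ((n : ℝ) - 1) < 1) :
    ∃ k ≤ n.factorial, EquidissectableWith k (hillSimplex v)
      (brick fun i : Fin n => if (i : ℕ) + 1 < n then √(1 + w) * brickP ((i : ℕ) + 1)
        else √((1 - w * ((n : ℝ) - 1)) / (n : ℝ))) := by
  have hc : 0 < 1 + w := by linarith
  have hd : 0 < 1 + w - n * w := by linarith
  obtain ⟨ι, _, hι, h⟩ := scissorsCongruent_hillSimplex_brick n (1 + w) w hc hd v hv.hasGram
  obtain ⟨b, rfl⟩ := hv.hasGram.exists_basis hc hd
  have hside : hillBrickSide n (1 + w) w = fun i : Fin n =>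
      if (i : ℕ) + 1 < n then √(1 + w) * brickP ((i : ℕ) + 1)
        else √((1 - w * ((n : ℝ) - 1)) / (n : ℝ)) := by
    funext i
    rw [hillBrickSide, show 1 + w - n * w = 1 - w * ((n : ℝ) - 1) by ring]
  rw [← hside, ← hι]
  exact h.equidissectableWith (isPolyhedron_hillSimplex b).convex (isCompact_hillSimplex b)
    (nonempty_interior_hillSimplex b) (convex_brick _)

theorem isHillSystem_single (n : ℕ) :
    IsHillSystem 0 fun i : Fin n => EuclideanSpace.single i (1 : ℝ) where
  norm_eq_one i := by simp
  inner_eq i j h := by simp [EuclideanSpace.inner_single_left, h]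

theorem mainTheorem3 (n : ℕ) (hn : 1 ≤ n) :
    (∃ k : ℕ, k ≤ n.factorial ∧
      EquidissectableWith k (orthoscheme n)
        (brick fun i : Fin n =>
          if (i : ℕ) + 1 < n then brickP ((i : ℕ) + 1) else 1 / √(n : ℝ))) ∧
    (∀ w : ℝ, -1 < w → w * ((n : ℝ) - 1) < 1 →
      ∀ v : Fin n → EuclideanSpace ℝ (Fin n), IsHillSystem w v →
        ∃ k : ℕ, k ≤ n.factorial ∧
          EquidissectableWith k (hillSimplex v)
            (brick fun i : Fin n =>
              if (i : ℕ) + 1 < n then √(1 + w) * brickP ((i : ℕ) + 1)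
              else √((1 - w * ((n : ℝ) - 1)) / (n : ℝ)))) := by
  refine ⟨?_, fun w hw hw' v hv => hv.exists_equidissectableWith_brick hw hw'⟩
  have := (isHillSystem_single n).exists_equidissectableWith_brick (by norm_num) (by norm_num)
  simpa [orthoscheme] using this
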